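/- Let $K$ be a field, let $P=K[x_1,\dots,x_n]$, let $\mathfrak{M}$ be a maximal ideal of $P$, and let $(g_1,\dots,g_n)$ be a regular sequence in $P$ which generates $\mathfrak{M}$. Let $\mathfrak{Q}\subset P$ be an $\mathfrak{M}$-primary ideal, and let $\{f_1,\dots,f_r\}$ be a system of generators of $\mathfrak{Q}$. For $j=1,\dots,r$, write $f_j=\sum_{k=1}^n a_{kj}\,g_k$ with $a_{kj}\in P$, and let $W=(a_{kj})$ be the corresponding $n\times r$ matrix over $P$. Then, for all $j_1,\dots,j_n\in\{1,\dots,r\}$, the following conditions are equivalent. (a) The residue class in $P/\mathfrak{Q}$ of the minor of $W$ formed by the columns $j_1,\dots,j_n$ (that is, of $\det(a_{k j_l})_{k,l=1,\dots,n}$) is non-zero. (b) The images of $f_{j_1},\dots,f_{j_n}$ in the localization $P_{\mathfrak{M}}$ form a regular sequence in $P_{\mathfrak{M}}$, and they generate the ideal $\mathfrak{Q}P_{\mathfrak{M}}$. Moreover, if $f_{j_1},\dots,f_{j_n}$ satisfy these equivalent conditions and the radical of the ideal $\langle f_{j_1},\dots,f_{j_n}\rangle$ of $P$ is $\mathfrak{M}$,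 then $\langle f_{j_1},\dots,f_{j_n}\rangle=\mathfrak{Q}$. -/

import Mathlib

/-!
Localizing at `M` turns the claim into one about a Noetherian local ring `A` whose maximal ideal
`m` is generated by a regular sequence `g` of length `n`, an `m`-primary ideal `Q`, and elements
`h = D g` of `Q`: then `det D ∉ Q` if and only if `h` is a regular sequence generating `Q`
(`det_notMem_iff`). Since `Q` and any ideal with radical `M` are primary, they are recovered from
their extensions to the localization, which gives the descent to the polynomial ring.

The core is Wiebe's theorem `det_notMem_span_and_socle`: if `h = D g` is a regular sequence of
length `n`, then `det D` is nonzero modulo `(h)` and generates the socle of `A / (h)`. The proof is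
an induction on `n`. By prime avoidance one replaces `g 0` by an element `y` of
`g 0 + (g 1, …, g (n - 1))` that is a nonzerodivisor modulo `I = (h 1, …, h (n - 1))`; Cramer's rule
gives `y * det D ≡ h 0 * δ` modulo `I`, with `δ` the complementary minor, and `δ` is the determinant
belonging to the sequence `h 1, …, h (n - 1)` in `A / (y)`.

If `h` is regular and generates `Q`, then `det D ∉ Q` follows at once. Conversely, if `det D ∉ Q`,
the sequence `h` is not known to be regular, so it is first moved by elements of a high power of `m`
to a regular sequence `z` (`exists_isWeaklyRegular_sub_mem`), which changes neither `det D` modulo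
`Q` nor `h` modulo `m Q`. If `(z) ≠ Q`, then `Q / (z)` would contain the one-dimensional socle of
the Artinian ring `A / (z)`, hence the determinant; so `(z) = Q`. By Nakayama `h` generates `Q` as
well, and exchanging the elements of `z` for those of `h` one at a time keeps the sequence regular.
-/

open RingTheory.Sequence IsLocalRing
open scoped Pointwise

/-! ### Prime avoidance in a coset -/

/-- If a nonzerodivisor `z` modulo `I` has a power in `(x) + J`, then the coset `x + J` contains a
nonzerodivisor modulo `I`: no associated prime of `A ⧸ I` contains both `x` and `J`. -/
theorem exists_add_isSMulRegular_quotient {A : Type*} [CommRing A] [IsNoetherianRing A]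
    {I J : Ideal A} {x z : A} (hz : IsSMulRegular (A ⧸ I) z)
    (hzJ : z ∈ (Ideal.span {x} ⊔ J).radical) :
    ∃ c ∈ J, IsSMulRegular (A ⧸ I) (x + c) := by
  classical
  have hfin := associatedPrimes.finite A (A ⧸ I)
  have hreg (r : A) : IsSMulRegular (A ⧸ I) r ↔ ∀ p ∈ associatedPrimes A (A ⧸ I), r ∉ p := by
    have := Set.ext_iff.1 (biUnion_associatedPrimes_eq_compl_regular A (A ⧸ I)) r
    simp only [Set.mem_iUnion, SetLike.mem_coe, exists_prop] at this
    rw [← not_iff_not]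
    push Not
    exact this.symm
  set S := associatedPrimes A (A ⧸ I)
  have hS : ∀ p ∈ S, p.IsPrime := fun p hp => hp.isPrime
  have hSfin : {p ∈ S | x ∈ p}.Finite := hfin.subset (Set.sep_subset _ _)
  have hTfin : {p ∈ S | ∀ q ∈ S, x ∈ q → ¬ p ≤ q}.Finite := hfin.subset (Set.sep_subset _ _)
  -- `c` is sought in `J` and in all associated primes that do not lie inside one containing `x`,
  -- but outside every associated prime containing `x`.
  have havoid : ¬ ((J ⊓ ∏ p ∈ hTfin.toFinset, p : Ideal A) : Set A) ⊆ ⋃ q ∈ {p ∈ S | x ∈ p}, q := by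
    rw [Ideal.subset_union_prime_finite hSfin ⊥ ⊥ fun q hq _ _ => hS q hq.1]
    rintro ⟨q, ⟨hq, hxq⟩, hle⟩
    have := hS q hq
    rcases (Ideal.IsPrime.inf_le this).1 hle with hJ | hprod
    · refine (hreg z).1 hz q hq ?_
      have : (Ideal.span {x} ⊔ J).radical ≤ q := by
        rw [Ideal.IsPrime.radical_le_iff this]
        exact sup_le ((Ideal.span_singleton_le_iff_mem _).2 hxq) hJ
      exact this hzJ
    · obtain ⟨p, hp, hpq⟩ := (Ideal.IsPrime.prod_le this).1 hprod
      exact ((Set.Finite.mem_toFinset _).1 hp).2 q hq hxq hpq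
  obtain ⟨c, hc, hcU⟩ := Set.not_subset.1 havoid
  simp only [Set.mem_iUnion, not_exists] at hcU
  have hxc (q : Ideal A) (hq : q ∈ S) (hxq : x ∈ q) : x + c ∉ q := fun h =>
    hcU q ⟨hq, hxq⟩ ((Ideal.add_mem_iff_right _ hxq).1 h)
  refine ⟨c, hc.1, (hreg _).2 fun p hp hmem => ?_⟩
  by_cases hT : ∀ q ∈ S, x ∈ q → ¬ p ≤ q
  · have hcp : c ∈ p :=
      (Ideal.prod_le_inf.trans (Finset.inf_le (f := id) ((Set.Finite.mem_toFinset hTfin).2 ⟨hp, hT⟩)))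
        hc.2
    have hxp : x ∈ p := (Ideal.add_mem_iff_left _ hcp).1 hmem
    exact hxc p hp hxp hmem
  · push Not at hT
    obtain ⟨q, hq, hxq, hpq⟩ := hT
    exact hxc q hq hxq (hpq hmem)

/-! ### Exchanging one element of a regular sequence in a local ring -/

theorem perm_ofFn_succAbove {α : Type*} {n : ℕ} (z : Fin (n + 1) → α) (i : Fin (n + 1)) :
    (List.ofFn z).Perm (List.ofFn (z ∘ i.succAbove) ++ [z i]) := by
  rw [← Multiset.coe_eq_coe, ← Fin.univ_val_map, Fin.univ_succAbove n i, ← Multiset.coe_add,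
    ← Fin.univ_val_map]
  simp [add_comm, Function.comp_def]

theorem ofList_ofFn {A : Type*} [CommRing A] {n : ℕ} (z : Fin n → A) :
    Ideal.ofList (List.ofFn z) = Ideal.span (Set.range z) := by
  refine congrArg Ideal.span (Set.ext fun x => ?_)
  simp [List.mem_ofFn]

section Local

variable {A : Type*} [CommRing A] [IsLocalRing A] [IsNoetherianRing A]

theorem isWeaklyRegular_ofFn_iff_succAbove {n : ℕ} {z : Fin (n + 1) → A}
    (hz : ∀ i, z i ∈ maximalIdeal A) (i : Fin (n + 1)) :
    IsWeaklyRegular A (List.ofFn z) ↔ IsWeaklyRegular A (List.ofFn (z ∘ i.succAbove)) ∧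
      IsSMulRegular (A ⧸ Ideal.span (Set.range (z ∘ i.succAbove))) (z i) := by
  have hperm := perm_ofFn_succAbove z i
  have hmem : ∀ r ∈ List.ofFn z, r ∈ maximalIdeal A := by
    intro r hr
    obtain ⟨k, rfl⟩ := (List.mem_ofFn' _ _).1 hr
    exact hz k
  have h : IsWeaklyRegular A (List.ofFn z) ↔
      IsWeaklyRegular A (List.ofFn (z ∘ i.succAbove) ++ [z i]) :=
    ⟨fun h => isWeaklyRegular_of_perm_of_subset_maximalIdeal h hperm hmem,
      fun h => isWeaklyRegular_of_perm_of_subset_maximalIdeal h hperm.symm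
        fun r hr => hmem r (hperm.mem_iff.2 hr)⟩
  rw [h, isWeaklyRegular_append_iff, isWeaklyRegular_singleton_iff, ofList_ofFn,
    smul_eq_mul, Ideal.mul_top]

/-- A variant of `isWeaklyRegular_cons_iff'` with the quotient ring in place of `QuotSMulTop`. -/
theorem isWeaklyRegular_cons_iff_quotient {R : Type*} [CommRing R] {n : ℕ} (y : R) (t : Fin n → R) :
    IsWeaklyRegular R (List.ofFn (Fin.cons y t : Fin (n + 1) → R)) ↔ IsSMulRegular R y ∧
      IsWeaklyRegular (R ⧸ Ideal.span {y})
        (List.ofFn fun k => Ideal.Quotient.mk (Ideal.span {y}) (t k)) := by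
  have hI : (y • (⊤ : Ideal R)) = Ideal.span {y} := by
    rw [← Submodule.ideal_span_singleton_smul, smul_eq_mul, Ideal.mul_top]
  rw [List.ofFn_succ]
  simp only [Fin.cons_zero, Fin.cons_succ]
  rw [isWeaklyRegular_cons_iff, (Submodule.quotEquivOfEq _ _ hI).isWeaklyRegular_congr,
    ← isWeaklyRegular_map_algebraMap_iff (R ⧸ Ideal.span {y}), List.map_ofFn]
  rfl

theorem isWeaklyRegular_update {n : ℕ} {z : Fin n → A} (hz : ∀ i, z i ∈ maximalIdeal A)
    (hreg : IsWeaklyRegular A (List.ofFn z)) (i : Fin n) {w : A} (hw : w ∈ maximalIdeal A)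
    (hreg' : IsSMulRegular (A ⧸ Ideal.span (z '' {i}ᶜ)) w) :
    IsWeaklyRegular A (List.ofFn (Function.update z i w)) := by
  obtain _ | n := n
  · exact i.elim0
  have hrange : z '' {i}ᶜ = Set.range (z ∘ i.succAbove) := by
    rw [Set.range_comp, Fin.range_succAbove]
  have hcomp : Function.update z i w ∘ i.succAbove = z ∘ i.succAbove := by
    ext k; simp [Fin.succAbove_ne]
  rw [isWeaklyRegular_ofFn_iff_succAbove (i := i), hcomp, Function.update_self]
  · exact ⟨((isWeaklyRegular_ofFn_iff_succAbove hz i).1 hreg).1, hrange ▸ hreg'⟩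
  · intro k
    rcases eq_or_ne k i with rfl | hk
    · simpa
    · simpa [hk] using hz k

theorem isSMulRegular_quotient_of_isWeaklyRegular {n : ℕ} {z : Fin n → A}
    (hz : ∀ i, z i ∈ maximalIdeal A) (hreg : IsWeaklyRegular A (List.ofFn z)) (i : Fin n) :
    IsSMulRegular (A ⧸ Ideal.span (z '' {i}ᶜ)) (z i) := by
  obtain _ | n := n
  · exact i.elim0
  have hrange : z '' {i}ᶜ = Set.range (z ∘ i.succAbove) := by
    rw [Set.range_comp, Fin.range_succAbove]
  exact hrange ▸ ((isWeaklyRegular_ofFn_iff_succAbove hz i).1 hreg).2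

/-! ### Changing generators modulo `m * I`, and perturbing to a regular sequence -/

theorem span_eq_of_sub_mem_maximalIdeal_mul {n : ℕ} {z w : Fin n → A} {I : Ideal A}
    (hI : Ideal.span (Set.range z) = I) (hzw : ∀ i, w i - z i ∈ maximalIdeal A * I) :
    Ideal.span (Set.range w) = I := by
  refine le_antisymm ?_ ?_
  · rw [Ideal.span_le]
    rintro _ ⟨i, rfl⟩
    have hzi : z i ∈ I := hI ▸ Ideal.subset_span ⟨i, rfl⟩
    have h1 : w i - z i ∈ I := Ideal.mul_le_right (hzw i)
    simpa using add_mem h1 hzi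
  · refine Submodule.le_of_le_smul_of_le_jacobson_bot (I := maximalIdeal A)
      (IsNoetherian.noetherian I) (maximalIdeal_le_jacobson _) ?_
    conv_lhs => rw [← hI]
    rw [Ideal.span_le]
    rintro _ ⟨i, rfl⟩
    have : z i = w i + -(w i - z i) := by ring
    rw [this]
    exact add_mem (Ideal.mem_sup_left (Ideal.subset_span ⟨i, rfl⟩))
      (Ideal.mem_sup_right (neg_mem (hzw i)))

/-- Changing a regular sequence that generates `I` by elements of `m * I` keeps it regular: each
new element is a unit multiple of the one it replaces, modulo the other elements. -/
theorem isWeaklyRegular_of_sub_mem_maximalIdeal_mul {n : ℕ} {z w : Fin n → A} {I : Ideal A}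
    (hz : ∀ i, z i ∈ maximalIdeal A) (hreg : IsWeaklyRegular A (List.ofFn z))
    (hI : Ideal.span (Set.range z) = I) (hzw : ∀ i, w i - z i ∈ maximalIdeal A * I) :
    IsWeaklyRegular A (List.ofFn w) := by
  classical
  have hw (i) : w i ∈ maximalIdeal A := by
    have h1 : w i - z i ∈ maximalIdeal A := Ideal.mul_le_left (hzw i)
    have h2 := add_mem h1 (hz i)
    rwa [sub_add_cancel] at h2
  suffices h : ∀ s : Finset (Fin n), IsWeaklyRegular A (List.ofFn (s.piecewise w z)) by
    simpa using h Finset.univ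
  intro s
  induction s using Finset.induction_on with
  | empty => simpa
  | insert i s his ih =>
    rw [Finset.piecewise_insert]
    set u := s.piecewise w z
    have hu (k) : u k ∈ maximalIdeal A := by
      by_cases hk : k ∈ s
      · simp only [u, Finset.piecewise_eq_of_mem _ _ _ hk, hw k]
      · simp only [u, Finset.piecewise_eq_of_notMem _ _ _ hk, hz k]
    have hui : u i = z i := Finset.piecewise_eq_of_notMem _ _ _ his
    have huI : Ideal.span (Set.range u) = I := by
      refine span_eq_of_sub_mem_maximalIdeal_mul hI fun k => ?_
      by_cases hk : k ∈ s
      · simpa only [u, Finset.piecewise_eq_of_mem _ _ _ hk] using hzw k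
      · simp only [u, Finset.piecewise_eq_of_notMem _ _ _ hk, sub_self, zero_mem]
    refine isWeaklyRegular_update hu ih i (hw i) ?_
    have hreg_i := isSMulRegular_quotient_of_isWeaklyRegular hu ih i
    set O := Ideal.span (u '' {i}ᶜ)
    have hI_sup : I = O ⊔ Ideal.span {u i} := by
      rw [← huI, ← Ideal.span_union, ← Set.image_singleton, ← Set.image_union, Set.compl_union_self,
        Set.image_univ]
    have hmI : maximalIdeal A * I ≤ O ⊔ maximalIdeal A * Ideal.span {u i} := by
      rw [hI_sup, Ideal.mul_sup]
      exact sup_le_sup_right Ideal.mul_le_right _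
    obtain ⟨o, ho, b, hb, hob⟩ := Submodule.mem_sup.1 (hmI (hzw i))
    obtain ⟨a, ha, rfl⟩ := Ideal.mem_mul_span_singleton.1 hb
    have hwi : w i = (1 + a) * u i + o := by
      rw [hui] at hob ⊢
      linear_combination -hob
    rw [isSMulRegular_quotient_iff_mem_of_smul_mem] at hreg_i ⊢
    intro x hx
    have hunit : IsUnit (1 + a) := by
      by_contra hcon
      have h1 : (1 : A) ∈ maximalIdeal A :=
        (Submodule.add_mem_iff_left _ ha).1 ((mem_maximalIdeal (1 + a)).2 hcon)
      exact (mem_maximalIdeal _).1 h1 isUnit_one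
    have h2 : u i • ((1 + a) * x) ∈ O := by
      have : u i • ((1 + a) * x) = w i • x - x * o := by
        rw [hwi, smul_eq_mul, smul_eq_mul]; ring
      rw [this]
      exact sub_mem hx (O.mul_mem_left _ ho)
    exact (O.unit_mul_mem_iff_mem hunit).1 (hreg_i _ h2)

/-- If the local ring has a regular sequence of length `n`, then any `n` elements of the maximal
ideal are congruent to a regular sequence modulo any given power of it. The elements of the
regular sequence are exchanged one at a time, so that no invariance of depth is needed. -/
theorem exists_isWeaklyRegular_sub_mem {n : ℕ} {g : Fin n → A}
    (hg : ∀ i, g i ∈ maximalIdeal A) (hreg : IsWeaklyRegular A (List.ofFn g))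
    {h : Fin n → A} (hh : ∀ i, h i ∈ maximalIdeal A) (N : ℕ) :
    ∃ z : Fin n → A, (∀ i, z i ∈ maximalIdeal A) ∧ (∀ i, z i - h i ∈ maximalIdeal A ^ (N + 1)) ∧
      IsWeaklyRegular A (List.ofFn z) := by
  classical
  suffices H : ∀ s : Finset (Fin n), ∃ z : Fin n → A, (∀ i, z i ∈ maximalIdeal A) ∧
      (∀ i ∈ s, z i - h i ∈ maximalIdeal A ^ (N + 1)) ∧ IsWeaklyRegular A (List.ofFn z) by
    simpa using H Finset.univ
  intro s
  induction s using Finset.induction_on with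
  | empty => exact ⟨g, hg, by simp, hreg⟩
  | insert i s his ih =>
    obtain ⟨z, hz, hzh, hzreg⟩ := ih
    obtain ⟨c, hc, hcreg⟩ := exists_add_isSMulRegular_quotient (x := h i)
      (J := maximalIdeal A ^ (N + 1)) (isSMulRegular_quotient_of_isWeaklyRegular hz hzreg i)
      ⟨N + 1, Ideal.mem_sup_right (Ideal.pow_mem_pow (hz i) _)⟩
    have hm : h i + c ∈ maximalIdeal A := add_mem (hh i) (Ideal.pow_le_self N.succ_ne_zero hc)
    refine ⟨Function.update z i (h i + c), fun k => ?_, fun k hk => ?_,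
      isWeaklyRegular_update hz hzreg i hm hcreg⟩
    · rcases eq_or_ne k i with rfl | hk
      · simpa only [Function.update_self]
      · simpa only [Function.update_of_ne hk] using hz k
    · rcases eq_or_ne k i with rfl | hki
      · simpa using hc
      · simpa [hki] using hzh k ((Finset.mem_insert.1 hk).resolve_left hki)

/-- A regular sequence whose length is the number of generators of the maximal ideal generates an
ideal that contains a power of it: the quotient has dimension zero. -/
theorem exists_maximalIdeal_pow_le_span {n : ℕ} {g h : Fin n → A}
    (hg : Ideal.span (Set.range g) = maximalIdeal A) (hh : ∀ i, h i ∈ maximalIdeal A)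
    (hreg : IsWeaklyRegular A (List.ofFn h)) :
    ∃ N : ℕ, maximalIdeal A ^ N ≤ Ideal.span (Set.range h) := by
  have hreg' : IsRegular A (List.ofFn h) := .of_isWeaklyRegular_of_mem_maximalIdeal A
    (fun r hr => by obtain ⟨k, rfl⟩ := (List.mem_ofFn' _ _).1 hr; exact hh k) hreg
  have hdim := ringKrullDim_add_length_eq_ringKrullDim_of_isRegular _ hreg'
  rw [ofList_ofFn, List.length_ofFn] at hdim
  have hrank : (maximalIdeal A).spanFinrank ≤ n := by
    rw [← hg]
    refine (Submodule.spanFinrank_span_le_ncard_of_finite (Set.finite_range g)).trans ?_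
    simpa [Set.image_univ] using Set.ncard_image_le (f := g) Set.finite_univ
  have hle : ringKrullDim (A ⧸ Ideal.span (Set.range h)) + n ≤ 0 + n := by
    rw [hdim, zero_add]
    exact (ringKrullDim_le_spanFinrank_maximalIdeal A).trans (mod_cast hrank)
  have hzero : Ring.KrullDimLE 0 (A ⧸ Ideal.span (Set.range h)) := by
    rw [Ring.krullDimLE_iff]
    exact ENat.WithBot.add_le_add_natCast_right_iff.1 hle
  refine Ideal.exists_pow_le_of_le_radical_of_fg ?_ (IsNoetherian.noetherian _)
  rw [Ideal.radical_eq_sInf]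
  refine le_sInf fun p ⟨hp, hprime⟩ => ?_
  have hker : RingHom.ker (Ideal.Quotient.mk (Ideal.span (Set.range h))) ≤ p := by
    rwa [Ideal.mk_ker]
  have := Ideal.map_isPrime_of_surjective Ideal.Quotient.mk_surjective hker
  have hmax := Ring.krullDimLE_zero_iff.1 hzero _ this
  have hp_max := Ideal.comap_isMaximal_of_surjective
    (Ideal.Quotient.mk (Ideal.span (Set.range h))) Ideal.Quotient.mk_surjective
    (K := p.map (Ideal.Quotient.mk _))
  rw [Ideal.comap_map_of_surjective' _ Ideal.Quotient.mk_surjective, sup_eq_left.2 hker] at hp_max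
  exact (eq_maximalIdeal hp_max).ge

end Local

/-! ### The determinant generates the socle -/

theorem mul_det_sub_mul_minor_mem {R : Type*} [CommRing R] {n : ℕ}
    (C : Matrix (Fin (n + 1)) (Fin (n + 1)) R) {g h : Fin (n + 1) → R}
    (hC : ∀ i, h i = ∑ k, C i k * g k) :
    g 0 * C.det - h 0 * (C.submatrix Fin.succ Fin.succ).det ∈
      Ideal.span (Set.range fun k : Fin n => h k.succ) := by
  have h1 : C.adjugate.mulVec h = C.det • g := by
    have : h = C.mulVec g := funext fun i => hC i
    rw [this, Matrix.mulVec_mulVec, Matrix.adjugate_mul, Matrix.smul_mulVec, Matrix.one_mulVec]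
  have h2 := congrFun h1 0
  rw [Matrix.mulVec, dotProduct, Fin.sum_univ_succ, Matrix.adjugate_fin_succ_eq_det_submatrix] at h2
  simp only [Fin.succAbove_zero, Pi.smul_apply, smul_eq_mul] at h2
  have h3 : g 0 * C.det - h 0 * (C.submatrix Fin.succ Fin.succ).det =
      ∑ k : Fin n, C.adjugate 0 k.succ * h k.succ := by
    simp at h2
    linear_combination -h2
  rw [h3]
  exact Ideal.sum_mem _ fun k _ => Ideal.mul_mem_left _ _ (Ideal.subset_span ⟨k, rfl⟩)

theorem mk_mem_span_range_iff {R : Type*} [CommRing R] {n : ℕ} {y x : R} {t : Fin n → R} :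
    Ideal.Quotient.mk (Ideal.span {y}) x ∈
      Ideal.span (Set.range fun k => Ideal.Quotient.mk (Ideal.span {y}) (t k)) ↔
      x ∈ Ideal.span (Set.range t) ⊔ Ideal.span {y} := by
  have : Ideal.span (Set.range fun k => Ideal.Quotient.mk (Ideal.span {y}) (t k)) =
      (Ideal.span (Set.range t)).map (Ideal.Quotient.mk (Ideal.span {y})) := by
    rw [Ideal.map_span, ← Set.range_comp]; rfl
  rw [this, ← Ideal.mem_comap, Ideal.comap_map_of_surjective' _ Ideal.Quotient.mk_surjective,
    Ideal.mk_ker]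

/-- Wiebe's theorem: if the maximal ideal is generated by `g` and `h = D g` is a regular sequence,
then `det D` is nonzero modulo `(h)` and generates the socle of the quotient by `(h)`. -/
theorem det_notMem_span_and_socle (n : ℕ) : ∀ {A : Type*} [CommRing A] [IsLocalRing A]
    [IsNoetherianRing A] {g h : Fin n → A} {D : Matrix (Fin n) (Fin n) A},
    Ideal.span (Set.range g) = maximalIdeal A → IsWeaklyRegular A (List.ofFn h) →
    (∀ i, h i = ∑ k, D i k * g k) →
    D.det ∉ Ideal.span (Set.range h) ∧
      ∀ x : A, (∀ u ∈ maximalIdeal A, u * x ∈ Ideal.span (Set.range h)) →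
        x ∈ Ideal.span (Set.range h) ⊔ Ideal.span {D.det} := by
  induction n with
  | zero =>
    intro A _ _ _ g h D hg hreg hD
    simp [Matrix.det_isEmpty]
  | succ n ih =>
    intro A _ _ _ g h D hg hreg hD
    have hgm (k) : g k ∈ maximalIdeal A := hg ▸ Ideal.subset_span ⟨k, rfl⟩
    have hh (i) : h i ∈ maximalIdeal A :=
      hD i ▸ sum_mem fun k _ => Ideal.mul_mem_left _ _ (hgm k)
    set t : Fin n → A := fun k => h k.succ with ht
    set I := Ideal.span (Set.range t) with hI
    have hspan : Ideal.span (Set.range h) = I ⊔ Ideal.span {h 0} := by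
      rw [hI, ← Ideal.span_union, Set.union_singleton, Fin.range_fin_succ]
      rfl
    have h0 : IsSMulRegular (A ⧸ I) (h 0) :=
      ((isWeaklyRegular_ofFn_iff_succAbove hh 0).1 hreg).2
    have htreg : IsWeaklyRegular A (List.ofFn t) :=
      ((isWeaklyRegular_ofFn_iff_succAbove hh 0).1 hreg).1
    obtain ⟨b, hb, hyreg⟩ := exists_add_isSMulRegular_quotient (x := g 0)
      (J := Ideal.span (Set.range fun k : Fin n => g k.succ)) h0
      (Ideal.le_radical (by
        rw [← Ideal.span_union, Set.singleton_union]
        exact (Fin.range_fin_succ g ▸ hg).ge (hh 0)))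
    obtain ⟨c, hc⟩ := (Ideal.mem_span_range_iff_exists_fun).1 hb
    set y := g 0 + b with hy
    have hym : y ∈ maximalIdeal A := by
      refine add_mem (hgm 0) (hc ▸ sum_mem fun k _ => Ideal.mul_mem_left _ _ (hgm _))
    -- `C` expresses `h` through `y, g 1, …` instead of `g 0, g 1, …`.
    let C : Matrix (Fin (n + 1)) (Fin (n + 1)) A :=
      Matrix.of fun i => Fin.cons (D i 0) fun k => D i k.succ - c k * D i 0
    have hdet : D.det = C.det := by
      rw [← Matrix.det_transpose, ← Matrix.det_transpose C]
      refine Matrix.det_eq_of_forall_row_eq_smul_add_const (Fin.cons 0 c) 0 rfl fun i j => ?_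
      refine Fin.cases ?_ (fun k => ?_) i
      · simp [C]
      · simp [C]
    have hC : ∀ i, h i = ∑ k, C i k * (Fin.cons y fun k => g k.succ : Fin (n + 1) → A) k := by
      intro i
      rw [hD i, Fin.sum_univ_succ, Fin.sum_univ_succ]
      simp only [C, Matrix.of_apply, Fin.cons_zero, Fin.cons_succ, hy, ← hc, sub_mul,
        Finset.sum_sub_distrib, mul_add, Finset.mul_sum]
      have : ∑ k, c k * D i 0 * g k.succ = ∑ k, D i 0 * (c k * g k.succ) :=
        Finset.sum_congr rfl fun k _ => by ring
      rw [this]; ring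
    set δ := (C.submatrix Fin.succ Fin.succ).det with hδ
    have key : y * D.det - h 0 * δ ∈ I := by
      rw [hdet]
      exact mul_det_sub_mul_minor_mem C hC
    -- The induction hypothesis applies to `h 1, …` in the quotient by `y`.
    have hyt : IsWeaklyRegular A (List.ofFn (Fin.cons y t : Fin (n + 1) → A)) := by
      rw [isWeaklyRegular_ofFn_iff_succAbove (i := 0)]
      · exact ⟨htreg, hyreg⟩
      · intro k
        refine Fin.cases hym (fun k => hh k.succ) k
    have hquot := ((isWeaklyRegular_cons_iff_quotient y t).1 hyt).2
    have : Nontrivial (A ⧸ Ideal.span {y}) := Ideal.Quotient.nontrivial_iff.2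
      (ne_top_of_le_ne_top (maximalIdeal.isMaximal A).ne_top
        ((Ideal.span_singleton_le_iff_mem _).2 hym))
    have : IsLocalRing (A ⧸ Ideal.span {y}) :=
      .of_surjective' (Ideal.Quotient.mk _) Ideal.Quotient.mk_surjective
    have hmax := map_maximalIdeal_of_surjective (Ideal.Quotient.mk (Ideal.span {y}))
      Ideal.Quotient.mk_surjective
    have hmy : Ideal.span (Set.range fun k : Fin n => Ideal.Quotient.mk (Ideal.span {y}) (g k.succ)) =
        maximalIdeal (A ⧸ Ideal.span {y}) := by
      refine le_antisymm ?_ ?_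
      · rw [Ideal.span_le]
        rintro _ ⟨k, rfl⟩
        exact hmax ▸ Ideal.mem_map_of_mem _ (hgm _)
      · rw [← hmax, Ideal.map_le_iff_le_comap, ← hg, Ideal.span_le]
        rintro _ ⟨k, rfl⟩
        rw [SetLike.mem_coe, Ideal.mem_comap, mk_mem_span_range_iff]
        refine Fin.cases ?_ (fun k => ?_) k
        · have : g 0 = -b + y := by rw [hy]; ring
          rw [this]
          exact Submodule.add_mem_sup (neg_mem hb) (Ideal.mem_span_singleton_self y)
        · exact Ideal.mem_sup_left (Ideal.subset_span ⟨k, rfl⟩)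
    obtain ⟨hδI, hsoc⟩ := ih (D := (C.submatrix Fin.succ Fin.succ).map
        (Ideal.Quotient.mk (Ideal.span {y}))) hmy hquot (fun i => by
      simp only [ht]
      rw [hC i.succ, Fin.sum_univ_succ]
      simp)
    rw [← RingHom.mapMatrix_apply, ← RingHom.map_det, ← hδ] at hδI hsoc
    rw [mk_mem_span_range_iff, ← hI] at hδI
    have hsoc' : ∀ z : A, (∀ u ∈ maximalIdeal A, u * z ∈ I ⊔ Ideal.span {y}) →
        ∃ i ∈ I, ∃ p q, z = i + y * p + δ * q := by
      intro z hz
      obtain ⟨a, ha, b, hb, hab⟩ := Submodule.mem_sup.1 (hsoc (Ideal.Quotient.mk _ z) fun u hu => by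
        rw [← hmax, Ideal.mem_map_iff_of_surjective _ Ideal.Quotient.mk_surjective] at hu
        obtain ⟨u, hu, rfl⟩ := hu
        rw [← map_mul, mk_mem_span_range_iff]
        exact hz u hu)
      obtain ⟨q, rfl⟩ := Ideal.mem_span_singleton'.1 hb
      obtain ⟨q, rfl⟩ := Ideal.Quotient.mk_surjective q
      have ha' : a = Ideal.Quotient.mk _ (z - q * δ) := by
        rw [map_sub, map_mul, ← hab, add_sub_cancel_right]
      rw [ha', mk_mem_span_range_iff] at ha
      obtain ⟨i, hi, b, hb, hib⟩ := Submodule.mem_sup.1 ha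
      obtain ⟨p, rfl⟩ := Ideal.mem_span_singleton'.1 hb
      exact ⟨i, hi, p, q, by linear_combination -hib⟩
    rw [isSMulRegular_quotient_iff_mem_of_smul_mem] at h0 hyreg
    simp only [smul_eq_mul] at h0 hyreg
    have hmem (x) : x ∈ Ideal.span (Set.range h) ↔ ∃ p, x - h 0 * p ∈ I := by
      rw [hspan, Submodule.mem_sup]
      constructor
      · rintro ⟨i, hi, b, hb, rfl⟩
        obtain ⟨p, rfl⟩ := Ideal.mem_span_singleton'.1 hb
        exact ⟨p, by simpa [mul_comm] using hi⟩
      · rintro ⟨p, hp⟩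
        exact ⟨_, hp, _, Ideal.mul_mem_right p _ (Ideal.mem_span_singleton_self _), by ring⟩
    refine ⟨fun hd => hδI ?_, fun x hx => ?_⟩
    · obtain ⟨p, hp⟩ := (hmem _).1 hd
      have : δ - y * p ∈ I := h0 _ (by
        have : h 0 * (δ - y * p) = y * (D.det - h 0 * p) - (y * D.det - h 0 * δ) := by ring
        rw [this]
        exact sub_mem (I.mul_mem_left _ hp) key)
      rw [← sub_add_cancel δ (y * p)]
      exact Submodule.add_mem_sup this (Ideal.mul_mem_right _ _ (Ideal.mem_span_singleton_self y))
    · -- Write `y * x ≡ h 0 * z` modulo `I`; then `z` is a socle element modulo `I + (y)`.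
      obtain ⟨z, hz⟩ := (hmem _).1 (hx y hym)
      obtain ⟨i, hi, p, q, hzpq⟩ := hsoc' z fun u hu => by
        obtain ⟨b, hb⟩ := (hmem _).1 (hx u hu)
        have : u * z - y * b ∈ I := h0 _ (by
          have : h 0 * (u * z - y * b) = y * (u * x - h 0 * b) - u * (y * x - h 0 * z) := by ring
          rw [this]
          exact sub_mem (I.mul_mem_left _ hb) (I.mul_mem_left _ hz))
        rw [← sub_add_cancel (u * z) (y * b)]
        exact Submodule.add_mem_sup this (Ideal.mul_mem_right _ _ (Ideal.mem_span_singleton_self y))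
      have hres : x - h 0 * p - D.det * q ∈ I := hyreg _ (by
        have : y * (x - h 0 * p - D.det * q) =
            (y * x - h 0 * z) + h 0 * i - q * (y * D.det - h 0 * δ) := by
          rw [hzpq]; ring
        rw [this]
        exact sub_mem (add_mem hz (I.mul_mem_left _ hi)) (I.mul_mem_left _ key))
      have : x = (x - D.det * q) + D.det * q := by ring
      rw [this]
      refine Submodule.add_mem_sup ((hmem _).2 ⟨p, ?_⟩)
        (Ideal.mul_mem_right _ _ (Ideal.mem_span_singleton_self _))
      convert hres using 1
      ring

/-! ### The local criterion -/

theorem det_mul_mem_span {R : Type*} [CommRing R] {n : ℕ} {D : Matrix (Fin n) (Fin n) R}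
    {g h : Fin n → R} (hD : ∀ i, h i = ∑ k, D i k * g k) {u : R}
    (hu : u ∈ Ideal.span (Set.range g)) : u * D.det ∈ Ideal.span (Set.range h) := by
  suffices Ideal.span (Set.range g) ≤ (Ideal.span (Set.range h)).colon {D.det} from
    Submodule.mem_colon_singleton.1 (this hu)
  rw [Ideal.span_le]
  rintro _ ⟨k, rfl⟩
  have hh : h = D.mulVec g := funext hD
  have hk : (D.adjugate.mulVec h) k = (D.det • g) k := by
    rw [hh, Matrix.mulVec_mulVec, Matrix.adjugate_mul, Matrix.smul_mulVec, Matrix.one_mulVec]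
  rw [SetLike.mem_coe, Submodule.mem_colon_singleton, smul_eq_mul, mul_comm]
  rw [Pi.smul_apply, smul_eq_mul] at hk
  rw [← hk, Matrix.mulVec, dotProduct]
  exact Ideal.sum_mem _ fun i _ => Ideal.mul_mem_left _ _ (Ideal.subset_span ⟨i, rfl⟩)

theorem det_add_sub_det_mem {R : Type*} [CommRing R] {n : ℕ} {Q : Ideal R}
    (D E : Matrix (Fin n) (Fin n) R) (hE : ∀ i k, E i k ∈ Q) : (D + E).det - D.det ∈ Q := by
  rw [← Ideal.Quotient.mk_eq_mk_iff_sub_mem, RingHom.map_det, RingHom.map_det]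
  congr 1
  ext i k
  simp [Ideal.Quotient.eq_zero_iff_mem.2 (hE i k)]

section Local

variable {A : Type*} [CommRing A] [IsLocalRing A] [IsNoetherianRing A]

/-- If the regular sequence `h = D g` lies in `Q` and does not generate it, then `Q` contains a
socle element modulo `(h)` that is not in `(h)`, hence `det D`. -/
theorem span_eq_of_det_notMem {n : ℕ} {g h : Fin n → A} {D : Matrix (Fin n) (Fin n) A}
    {Q : Ideal A} (hg : Ideal.span (Set.range g) = maximalIdeal A)
    (hreg : IsWeaklyRegular A (List.ofFn h)) (hD : ∀ i, h i = ∑ k, D i k * g k)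
    (hQ : ∀ i, h i ∈ Q) (hdet : D.det ∉ Q) : Ideal.span (Set.range h) = Q := by
  classical
  have hle : Ideal.span (Set.range h) ≤ Q := Ideal.span_le.2 (Set.range_subset_iff.2 hQ)
  refine hle.antisymm ?_
  by_contra hlt
  have hh (i) : h i ∈ maximalIdeal A :=
    hD i ▸ sum_mem fun k _ => Ideal.mul_mem_left _ _ (hg ▸ Ideal.subset_span ⟨k, rfl⟩)
  have hex : ∃ k, maximalIdeal A ^ k * Q ≤ Ideal.span (Set.range h) := by
    obtain ⟨k, hk⟩ := exists_maximalIdeal_pow_le_span hg hh hreg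
    exact ⟨k, Ideal.mul_le_left.trans hk⟩
  obtain ⟨k, hk, hmin⟩ : ∃ k, maximalIdeal A ^ (k + 1) * Q ≤ Ideal.span (Set.range h) ∧
      ¬ maximalIdeal A ^ k * Q ≤ Ideal.span (Set.range h) := by
    rcases hfind : Nat.find hex with _ | k
    · have := hfind ▸ Nat.find_spec hex
      simp only [pow_zero, Ideal.one_eq_top, Ideal.top_mul] at this
      exact absurd this hlt
    · exact ⟨k, hfind ▸ Nat.find_spec hex, Nat.find_min hex (by omega)⟩
  -- Minimality of the exponent makes `x` a socle element.
  obtain ⟨x, hx, hxI⟩ := SetLike.not_le_iff_exists.1 hmin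
  have hsocle := (det_notMem_span_and_socle n hg hreg hD).2 x fun u hu => hk (by
    rw [pow_succ', mul_assoc]
    exact Ideal.mul_mem_mul hu hx)
  obtain ⟨i, hi, b, hb, rfl⟩ := Submodule.mem_sup.1 hsocle
  obtain ⟨a, rfl⟩ := Ideal.mem_span_singleton'.1 hb
  -- For a nonunit `a`, Cramer's rule puts `a * det D`, and with it `x`, into `(h)`.
  by_cases ha : IsUnit a
  · refine hdet ((Q.unit_mul_mem_iff_mem ha).1 ?_)
    have h1 : i + a * D.det ∈ Q := Ideal.mul_le_right hx
    exact (Ideal.add_mem_iff_right _ (hle hi)).1 h1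
  · refine hxI (add_mem hi (det_mul_mem_span hD ?_))
    rw [hg]
    exact (mem_maximalIdeal a).2 ha

/-- The equivalence of the two conditions for an ideal of a local ring whose maximal ideal is
generated by a regular sequence. -/
theorem det_notMem_iff {n : ℕ} {g h : Fin n → A} {D : Matrix (Fin n) (Fin n) A}
    {Q : Ideal A} (hg : Ideal.span (Set.range g) = maximalIdeal A)
    (hgreg : IsWeaklyRegular A (List.ofFn g)) {N : ℕ} (hN : maximalIdeal A ^ N ≤ Q)
    (hD : ∀ i, h i = ∑ k, D i k * g k) (hQ : ∀ i, h i ∈ Q) :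
    D.det ∉ Q ↔ IsWeaklyRegular A (List.ofFn h) ∧ Ideal.span (Set.range h) = Q := by
  refine ⟨fun hdet => ?_, fun ⟨hreg, hspan⟩ =>
    hspan ▸ (det_notMem_span_and_socle n hg hreg hD).1⟩
  have hgm (k) : g k ∈ maximalIdeal A := hg ▸ Ideal.subset_span ⟨k, rfl⟩
  have hh (i) : h i ∈ maximalIdeal A := hD i ▸ sum_mem fun k _ => Ideal.mul_mem_left _ _ (hgm k)
  obtain ⟨z, hz, hzh, hzreg⟩ := exists_isWeaklyRegular_sub_mem hgm hgreg hh N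
  have hE (i) : ∃ e : Fin n → A, (∀ k, e k ∈ maximalIdeal A ^ N) ∧ z i - h i = ∑ k, e k * g k := by
    have hi := hzh i
    rw [pow_succ, ← hg, ← smul_eq_mul] at hi
    obtain ⟨a, ha, hsum⟩ := (Submodule.mem_ideal_smul_span_iff_exists_sum _ g _).1 hi
    rw [hg] at ha
    exact ⟨a, ha, by rw [← hsum, Finsupp.sum_fintype _ _ (by simp)]; rfl⟩
  choose E hEm hEz using hE
  have hzQ (i) : z i - h i ∈ maximalIdeal A * Q := by
    have := hzh i
    rw [pow_succ'] at this
    exact Ideal.mul_mono_right hN this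
  have hspan : Ideal.span (Set.range z) = Q := by
    refine span_eq_of_det_notMem (D := D + Matrix.of E) hg hzreg (fun i => ?_) (fun i => ?_) ?_
    · simp only [Matrix.add_apply, Matrix.of_apply, add_mul, Finset.sum_add_distrib, ← hD, ← hEz]
      ring
    · have h1 : z i - h i ∈ Q := Ideal.mul_le_right (hzQ i)
      simpa using add_mem h1 (hQ i)
    · intro hmem
      have := det_add_sub_det_mem D (Matrix.of E) (Q := Q) fun i k => hN (hEm i k)
      exact hdet ((Submodule.sub_mem_iff_right Q hmem).1 this)
  have hzw (i) : h i - z i ∈ maximalIdeal A * Q := by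
    rw [← neg_sub]
    exact neg_mem (hzQ i)
  exact ⟨isWeaklyRegular_of_sub_mem_maximalIdeal_mul hz hzreg hspan hzw,
    span_eq_of_sub_mem_maximalIdeal_mul hspan hzw⟩

end Local

/-! ### Descent to the polynomial ring -/

theorem proposition3p7 {K : Type*} [Field K] (n r : ℕ)
    (M : Ideal (MvPolynomial (Fin n) K)) [M.IsMaximal]
    (g : Fin n → MvPolynomial (Fin n) K)
    (hg_reg : RingTheory.Sequence.IsRegular (MvPolynomial (Fin n) K) (List.ofFn g))
    (hg_span : Ideal.span (Set.range g) = M)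
    (Q : Ideal (MvPolynomial (Fin n) K)) (hQ_prim : Q.IsPrimary) (hQ_rad : Q.radical = M)
    (f : Fin r → MvPolynomial (Fin n) K) (hf_span : Ideal.span (Set.range f) = Q)
    (W : Matrix (Fin n) (Fin r) (MvPolynomial (Fin n) K))
    (hW : ∀ j : Fin r, f j = ∑ k : Fin n, W k j * g k)
    (j : Fin n → Fin r) :
    (Ideal.Quotient.mk Q (W.submatrix id j).det ≠ 0 ↔
      (RingTheory.Sequence.IsRegular (Localization.AtPrime M)
          (List.ofFn fun i : Fin n =>
            algebraMap (MvPolynomial (Fin n) K) (Localization.AtPrime M) (f (j i))) ∧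
        Ideal.span (Set.range fun i : Fin n =>
            algebraMap (MvPolynomial (Fin n) K) (Localization.AtPrime M) (f (j i))) =
          Q.map (algebraMap (MvPolynomial (Fin n) K) (Localization.AtPrime M)))) ∧
    (Ideal.Quotient.mk Q (W.submatrix id j).det ≠ 0 →
      (Ideal.span (Set.range fun i : Fin n => f (j i))).radical = M →
      Ideal.span (Set.range fun i : Fin n => f (j i)) = Q) := by
  set φ := algebraMap (MvPolynomial (Fin n) K) (Localization.AtPrime M)
  have : IsNoetherianRing (Localization.AtPrime M) :=
    IsLocalization.isNoetherianRing M.primeCompl _ inferInstance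
  have hMmap : M.map φ = maximalIdeal (Localization.AtPrime M) :=
    Localization.AtPrime.map_eq_maximalIdeal
  have hfQ (i) : f i ∈ Q := hf_span ▸ Ideal.subset_span ⟨i, rfl⟩
  have hQM : Q ≤ M := hQ_rad ▸ Ideal.le_radical
  have hspan_map {s : ℕ} (t : Fin s → MvPolynomial (Fin n) K) :
      Ideal.span (Set.range fun i => φ (t i)) = (Ideal.span (Set.range t)).map φ := by
    rw [Ideal.map_span, ← Set.range_comp]; rfl
  have hcontract {I : Ideal (MvPolynomial (Fin n) K)} (hI : I.IsPrimary) (hIM : I ≤ M) :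
      (I.map φ).comap φ = I :=
    IsLocalization.under_map_of_isPrimary_disjoint M.primeCompl _ hI
      (Set.disjoint_left.2 fun a ha ha' => ha (hIM ha'))
  obtain ⟨N, hN⟩ := Ideal.exists_pow_le_of_le_radical_of_fg hQ_rad.ge (IsNoetherian.noetherian M)
  have hlocal : (W.submatrix id j).det ∉ Q ↔
      IsWeaklyRegular (Localization.AtPrime M) (List.ofFn fun i => φ (f (j i))) ∧
        Ideal.span (Set.range fun i => φ (f (j i))) = Q.map φ := by
    -- `W` has the coefficients of `f j` in its columns, the local criterion has them in rows.
    rw [← det_notMem_iff (g := fun k => φ (g k)) (D := ((W.submatrix id j).map φ).transpose)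
      (N := N), Matrix.det_transpose, ← RingHom.mapMatrix_apply, ← RingHom.map_det,
      ← Ideal.mem_comap, hcontract hQ_prim hQM]
    · rw [hspan_map, hg_span, hMmap]
    · have := hg_reg.toIsWeaklyRegular.of_isLocalization (Localization.AtPrime M) M.primeCompl
      rwa [List.map_ofFn] at this
    · rw [← hMmap, ← Ideal.map_pow]
      exact Ideal.map_mono hN
    · intro i
      simp [hW (j i)]
    · exact fun i => Ideal.mem_map_of_mem _ (hfQ _)
  rw [ne_eq, Ideal.Quotient.eq_zero_iff_mem]
  refine ⟨?_, fun hdet hrad => ?_⟩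
  · rw [hlocal, isRegular_iff_isWeaklyRegular_of_subset_maximalIdeal]
    intro x hx
    obtain ⟨i, rfl⟩ := (List.mem_ofFn' _ _).1 hx
    exact hMmap ▸ Ideal.mem_map_of_mem φ (hQM (hfQ _))
  · have hprim : (Ideal.span (Set.range fun i => f (j i))).IsPrimary :=
      Ideal.isPrimary_of_isMaximal_radical (hrad ▸ inferInstance)
    rw [← hcontract hprim (Ideal.le_radical.trans hrad.le), ← hspan_map, (hlocal.1 hdet).2,
      hcontract hQ_prim hQM]
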